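/- Let $n\ge 2$. The unrestricted virtual braid group $UVB_n$ is the group with generators $\sigma_1,\dots,\sigma_{n-1},\rho_1,\dots,\rho_{n-1}$ and the following relations, for all admissible indices: $$\sigma_i\sigma_{i+1}\sigma_i=\sigma_{i+1}\sigma_i\sigma_{i+1},\quad \rho_i\rho_{i+1}\rho_i=\rho_{i+1}\rho_i\rho_{i+1},\quad \rho_i^2=1,\quad \rho_i\rho_{i+1}\sigma_i=\sigma_{i+1}\rho_i\rho_{i+1},$$ $$\rho_i\sigma_{i+1}\sigma_i=\sigma_{i+1}\sigma_i\rho_{i+1},\quad \rho_{i+1}\sigma_i\sigma_{i+1}=\sigma_i\sigma_{i+1}\rho_i,$$ $$\sigma_i\sigma_j=\sigma_j\sigma_i,\quad \rho_i\rho_j=\rho_j\rho_i,\quad \sigma_i\rho_j=\rho_j\sigma_i\quad\text{if } |i-j|\ge 2.$$ Let $UVP_n$ be the kernel of the homomorphism $UVB_n\to S_n$ that sends $\sigma_i$ and $\rho_i$ to the transposition $(i\ \ i+1)$. Put $\lambda_{n-1,n}=\rho_{n-1}\sigma_{n-1}^{-1}$, $\lambda_{n,n-1}=\rho_{n-1}\lambda_{n-1,n}\rho_{n-1}=\sigma_{n-1}^{-1}\rho_{n-1}$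 and $[u,v]=u^{-1}v^{-1}uv$. An oriented fused link diagram is a generic immersion of finitely many oriented circles in the plane whose double points are marked as classical (with over/under information) or virtual. Two such diagrams are equivalent as fused links if they are related by a finite sequence of ambient isotopies of the plane, classical, virtual and mixed Reidemeister moves, and both forbidden moves (a strand that passes over two other strands, or under two other strands, may be moved across a virtual crossing of these two). The closure of a braid is the diagram obtained by drawing a word that represents the braid, with a classical crossing of one type for each $\sigma_i$, of the other type for each $\sigma_i^{-1}$, and a virtual crossing for each $\rho_i$, and joining the corresponding ends by parallel arcs. Let $\alpha\in UVP_n$ and let $u,v$ be elements of the subgroup $\langle\lambda_{n-1,n},\lambda_{n,n-1}\rangle$ of $UVB_n$. Then the closures of $\alpha$ and of $\alpha[u,v]$ are equivalent fused links (for any choice of words representing the two braids). -/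

import Mathlib

namespace FusedLinks

/-! ### The unrestricted virtual braid group

Indices are shifted by one: the value `i : Fin (n - 1)` stands for the paper's index `i + 1`, so
that `sigma i` exchanges the strands `i` and `i + 1` of the `n` strands `0, ..., n - 1`. -/

/-- The generators of the unrestricted virtual braid group on `n` strands. -/
inductive Gen (n : ℕ) : Type
  | sigma (i : Fin (n - 1)) : Gen n
  | rho (i : Fin (n - 1)) : Gen n

/-- The generator `sigma_i` of the free group. -/
def fs {n : ℕ} (i : Fin (n - 1)) : FreeGroup (Gen n) := FreeGroup.of (Gen.sigma i)

/-- The generator `rho_i` of the free group. -/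
def fr {n : ℕ} (i : Fin (n - 1)) : FreeGroup (Gen n) := FreeGroup.of (Gen.rho i)

/-- `|i - j| ≥ 2`. -/
def Far {m : ℕ} (i j : Fin m) : Prop := i.val + 2 ≤ j.val ∨ j.val + 2 ≤ i.val

/-- The defining relations of the unrestricted virtual braid group; `j` is the successor of `i`
wherever `i.val + 1 = j.val` is required. -/
inductive BraidRel (n : ℕ) : FreeGroup (Gen n) → FreeGroup (Gen n) → Prop
  | b1 (i j : Fin (n - 1)) (h : i.val + 1 = j.val) :
      BraidRel n (fs i * fs j * fs i) (fs j * fs i * fs j)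
  | b2 (i j : Fin (n - 1)) (h : Far i j) : BraidRel n (fs i * fs j) (fs j * fs i)
  | p1 (i j : Fin (n - 1)) (h : i.val + 1 = j.val) :
      BraidRel n (fr i * fr j * fr i) (fr j * fr i * fr j)
  | p2 (i j : Fin (n - 1)) (h : Far i j) : BraidRel n (fr i * fr j) (fr j * fr i)
  | p3 (i : Fin (n - 1)) : BraidRel n (fr i * fr i) 1
  | m1 (i j : Fin (n - 1)) (h : Far i j) : BraidRel n (fs i * fr j) (fr j * fs i)
  | m2 (i j : Fin (n - 1)) (h : i.val + 1 = j.val) :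
      BraidRel n (fr i * fr j * fs i) (fs j * fr i * fr j)
  | f1 (i j : Fin (n - 1)) (h : i.val + 1 = j.val) :
      BraidRel n (fr i * fs j * fs i) (fs j * fs i * fr j)
  | f2 (i j : Fin (n - 1)) (h : i.val + 1 = j.val) :
      BraidRel n (fr j * fs i * fs j) (fs i * fs j * fr i)

/-- The relators of the unrestricted virtual braid group. -/
def braidRels (n : ℕ) : Set (FreeGroup (Gen n)) :=
  {z | ∃ x y, BraidRel n x y ∧ z = x * y⁻¹}

/-- The unrestricted virtual braid group `UVB_n`. -/
abbrev UVB (n : ℕ) : Type := PresentedGroup (braidRels n)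

/-- The generator `sigma_i` of `UVB_n`. -/
def sigma {n : ℕ} (i : Fin (n - 1)) : UVB n := PresentedGroup.of (Gen.sigma i)

/-- The generator `rho_i` of `UVB_n`. -/
def rho {n : ℕ} (i : Fin (n - 1)) : UVB n := PresentedGroup.of (Gen.rho i)

/-- The transposition of `i` and `i + 1`. -/
def tau {n : ℕ} (i : Fin (n - 1)) : Equiv.Perm (Fin n) :=
  Equiv.swap ⟨i.val, by omega⟩ ⟨i.val + 1, by omega⟩

/-- The permutation assigned to a generator. -/
def genPerm {n : ℕ} : Gen n → Equiv.Perm (Fin n)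
  | Gen.sigma i => tau i
  | Gen.rho i => tau i

theorem tau_sq {n : ℕ} (i : Fin (n - 1)) : tau i * tau i = 1 := by
  simp [tau]

theorem tau_braid {n : ℕ} (i j : Fin (n - 1)) (h : i.val + 1 = j.val) :
    tau i * tau j * tau i = tau j * tau i * tau j := by
  obtain ⟨i, hi⟩ := i
  obtain ⟨j, hj⟩ := j
  simp only at h
  subst h
  simp only [tau]
  have h1 := Equiv.swap_mul_swap_mul_swap (x := (⟨i + 1 + 1, by omega⟩ : Fin n))
    (y := ⟨i + 1, by omega⟩) (z := ⟨i, by omega⟩) (by simp) (by simp [Fin.ext_iff]; omega)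
  have h2 := Equiv.swap_mul_swap_mul_swap (x := (⟨i, by omega⟩ : Fin n))
    (y := ⟨i + 1, by omega⟩) (z := ⟨i + 1 + 1, by omega⟩) (by simp) (by simp [Fin.ext_iff]; omega)
  rw [Equiv.swap_comm (⟨i, _⟩ : Fin n) ⟨i + 1, _⟩,
    Equiv.swap_comm (⟨i + 1, _⟩ : Fin n) ⟨i + 1 + 1, _⟩, h1,
    Equiv.swap_comm (⟨i + 1 + 1, _⟩ : Fin n) ⟨i + 1, _⟩,
    Equiv.swap_comm (⟨i + 1, _⟩ : Fin n) ⟨i, _⟩, h2, Equiv.swap_comm]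

theorem tau_comm {n : ℕ} (i j : Fin (n - 1)) (h : Far i j) : tau i * tau j = tau j * tau i := by
  apply Equiv.Perm.Disjoint.commute
  unfold Far at h
  unfold tau
  apply Equiv.Perm.disjoint_swap_swap
  simp [Fin.ext_iff]
  omega

theorem lift_braidRel {n : ℕ} {x y : FreeGroup (Gen n)} (h : BraidRel n x y) :
    FreeGroup.lift genPerm x = FreeGroup.lift genPerm y := by
  cases h <;> simp only [fs, fr, map_mul, FreeGroup.lift_apply_of, genPerm, map_one]
  case p3 i => exact tau_sq i
  case b2 i j h => exact tau_comm i j h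
  case p2 i j h => exact tau_comm i j h
  case m1 i j h => exact tau_comm i j h
  case f2 i j h => exact (tau_braid i j h).symm
  all_goals exact tau_braid _ _ ‹_›

/-- The homomorphism `UVB_n → S_n` with `sigma_i, rho_i ↦ (i i+1)`. -/
def iota (n : ℕ) : UVB n →* Equiv.Perm (Fin n) :=
  PresentedGroup.toGroup (f := genPerm) (rels := braidRels n) (by
    rintro _ ⟨x, y, h, rfl⟩
    rw [map_mul, map_inv, lift_braidRel h, mul_inv_cancel])

/-- The pure unrestricted virtual braid group `UVP_n`. -/
def UVP (n : ℕ) : Subgroup (UVB n) := (iota n).ker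

/-- `lambda_{i,i+1} = rho_i sigma_i⁻¹`. -/
def lamUp {n : ℕ} (i : Fin (n - 1)) : UVB n := rho i * (sigma i)⁻¹

/-- `lambda_{i+1,i} = rho_i lambda_{i,i+1} rho_i`. -/
def lamDown {n : ℕ} (i : Fin (n - 1)) : UVB n := rho i * lamUp i * rho i

/-! ### Fused link diagrams

An oriented diagram in the plane is put in Morse position with respect to the height and is read
from top to bottom, one elementary piece (a local maximum, a local minimum or a double point)
at a time. A horizontal level is recorded by the orientations of the strands it meets, from left
to right (`true` for downwards). Ambient isotopy of the plane becomes the moves listed in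
`PlanarMove`. -/

/-- The types of a double point: classical, where the strand from upper left to lower right passes
over (`over`) or under (`under`) the other one, or virtual. -/
inductive Crossing : Type
  | over | under | virt

/-- The same double point when the two strands trade their roles, that is, when the strand that
went from upper left to lower right now goes from upper right to lower left. -/
def Crossing.flip : Crossing → Crossing
  | .over => .under
  | .under => .over
  | .virt => .virt

/-- The double point is classical. -/
def Crossing.IsClassical : Crossing → Prop
  | .over => True
  | .under => True
  | .virt => False

/-- Elementary pieces: a local maximum, whose left leg is oriented by `o`; a local minimum;
a double point. -/
inductive Piece : Type
  | top (o : Bool) : Piece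
  | bot : Piece
  | cross (k : Crossing) : Piece

/-- The number of strands that enter a piece from above. -/
def Piece.inArity : Piece → ℕ
  | .top _ => 0
  | .bot => 2
  | .cross _ => 2

/-- The number of strands that leave a piece below. -/
def Piece.outArity : Piece → ℕ
  | .top _ => 2
  | .bot => 0
  | .cross _ => 2

/-- The level below a piece placed at the left end of the level `s`, if the piece fits there. -/
def Piece.act : Piece → List Bool → Option (List Bool)
  | .top o, s => some (o :: (!o) :: s)
  | .bot, a :: b :: s => if b = !a then some s else none
  | .cross _, a :: b :: s => some (b :: a :: s)
  | _, _ => none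

/-- The level below a piece placed to the right of the first `p` strands of a level. -/
def actAt : ℕ → Piece → List Bool → Option (List Bool)
  | 0, g, s => g.act s
  | p + 1, g, a :: s => (actAt p g s).map (fun t => a :: t)
  | _ + 1, _, [] => none

/-- A layer `(p, g)`: the piece `g` with exactly `p` strands to its left. -/
abbrev Layer : Type := ℕ × Piece

/-- The level below a stack of layers, if every layer fits. -/
def run : List Layer → List Bool → Option (List Bool)
  | [], s => some s
  | l :: L, s => (actAt l.1 l.2 s).bind (run L)

/-- An oriented fused link diagram. -/
structure Diagram : Type where
  layers : List Layer
  closed : run layers [] = some []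

/-- Local moves that realize ambient isotopies of the plane. -/
inductive PlanarMove : List Layer → List Layer → Prop
  /-- Two pieces that lie side by side exchange their heights. -/
  | exchange (p r : ℕ) (g h : Piece) :
      PlanarMove [(p, g), (p + g.outArity + r, h)] [(p + g.inArity + r, h), (p, g)]
  /-- A maximum and a minimum next to each other cancel. -/
  | zigzagRight (p : ℕ) (o : Bool) : PlanarMove [(p + 1, .top o), (p, .bot)] []
  | zigzagLeft (p : ℕ) (o : Bool) : PlanarMove [(p, .top o), (p + 1, .bot)] []
  /-- A double point passes from one leg of a minimum to the other. -/
  | pitchforkBot (p : ℕ) (k : Crossing) :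
      PlanarMove [(p, .cross k), (p + 1, .bot)] [(p + 1, .cross k.flip), (p, .bot)]
  /-- A double point passes from one leg of a maximum to the other. -/
  | pitchforkTop (p : ℕ) (o : Bool) (k : Crossing) :
      PlanarMove [(p, .top o), (p + 1, .cross k)] [(p + 1, .top o), (p, .cross k.flip)]

/-- The triples of double points, of the strands 1 and 2, 1 and 3, 2 and 3 (numbered from left to
right at the top), for which the third Reidemeister type move is allowed. -/
inductive TriangleMove : Crossing → Crossing → Crossing → Prop
  /-- The classical move: the three strands are at three different heights, so that neither
  `over, under, over` nor `under, over, under` occurs. -/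
  | classical (a b c : Crossing) (ha : a.IsClassical) (hb : b.IsClassical) (hc : c.IsClassical)
      (h : ¬ (a = c ∧ b = a.flip)) : TriangleMove a b c
  /-- The virtual move. -/
  | virtual : TriangleMove .virt .virt .virt
  /-- The mixed move: a strand with two virtual double points passes a classical one. -/
  | mixed1 (k : Crossing) (hk : k.IsClassical) : TriangleMove .virt .virt k
  | mixed2 (k : Crossing) (hk : k.IsClassical) : TriangleMove .virt k .virt
  | mixed3 (k : Crossing) (hk : k.IsClassical) : TriangleMove k .virt .virt
  /-- The forbidden moves: a strand (1, 2 or 3) that passes over the two others, or under the two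
  others, passes their virtual double point. -/
  | forbidden1 (k : Crossing) (hk : k.IsClassical) : TriangleMove k k .virt
  | forbidden2 (k : Crossing) (hk : k.IsClassical) : TriangleMove k .virt k.flip
  | forbidden3 (k : Crossing) (hk : k.IsClassical) : TriangleMove .virt k k

/-- The generalized Reidemeister moves (classical, virtual, mixed and forbidden). -/
inductive ReidemeisterMove : List Layer → List Layer → Prop
  /-- First moves, classical or virtual: a kink to the right or to the left of a strand. -/
  | oneRight (p : ℕ) (o : Bool) (k : Crossing) :
      ReidemeisterMove [(p + 1, .top o), (p, .cross k), (p + 1, .bot)] []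
  | oneLeft (p : ℕ) (o : Bool) (k : Crossing) :
      ReidemeisterMove [(p, .top o), (p + 1, .cross k), (p, .bot)] []
  /-- Second moves, classical or virtual. -/
  | two (p : ℕ) (k : Crossing) : ReidemeisterMove [(p, .cross k), (p, .cross k.flip)] []
  /-- Third moves, mixed moves and forbidden moves. -/
  | three (p : ℕ) (a b c : Crossing) (h : TriangleMove a b c) :
      ReidemeisterMove [(p, .cross a), (p + 1, .cross b), (p, .cross c)]
        [(p + 1, .cross c), (p, .cross b), (p + 1, .cross a)]

/-- `E` is obtained from `D` by one local move. Both are diagrams, so the strands that the move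
needs are there, with matching orientations. -/
def Step (D E : Diagram) : Prop :=
  ∃ A X Y B : List Layer, (PlanarMove X Y ∨ ReidemeisterMove X Y) ∧
    D.layers = A ++ X ++ B ∧ E.layers = A ++ Y ++ B

/-- Two diagrams are equivalent, that is, they represent the same fused link. -/
def FusedEquivalent (D E : Diagram) : Prop := Relation.EqvGen Step D E

/-! ### Closures of braids -/

/-- Letters of braid diagrams on `n` strands. -/
inductive Letter (n : ℕ) : Type
  | sigma (i : Fin (n - 1)) : Letter n
  | sigmaInv (i : Fin (n - 1)) : Letter n
  | rho (i : Fin (n - 1)) : Letter n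

/-- The element of `UVB_n` given by a letter. -/
def Letter.toUVB {n : ℕ} : Letter n → UVB n
  | .sigma i => FusedLinks.sigma i
  | .sigmaInv i => (FusedLinks.sigma i)⁻¹
  | .rho i => FusedLinks.rho i

/-- The braid represented by a braid diagram, given as a word. -/
def braidOf {n : ℕ} (w : List (Letter n)) : UVB n := (w.map Letter.toUVB).prod

/-- The double point given by a letter. -/
def Letter.layer {n : ℕ} : Letter n → Layer
  | .sigma i => (i.val, .cross .over)
  | .sigmaInv i => (i.val, .cross .under)
  | .rho i => (i.val, .cross .virt)

/-- The layers of the closure of a braid diagram: the `n` strands run downwards, and their ends are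
joined by `n` nested arcs on the right of the braid. -/
def closureLayers {n : ℕ} (w : List (Letter n)) : List Layer :=
  (List.range n).map (fun i => (i, Piece.top true)) ++ w.map Letter.layer ++
    (List.range n).reverse.map (fun i => (i, Piece.bot))

theorem run_append (L M : List Layer) (s : List Bool) :
    run (L ++ M) s = (run L s).bind (run M) := by
  induction L generalizing s with
  | nil => rfl
  | cons l L ih =>
    simp only [List.cons_append, run]
    cases actAt l.1 l.2 s with
    | none => rfl
    | some t => simpa using ih t

theorem actAt_append (u : List Bool) (g : Piece) (s : List Bool) :
    actAt u.length g (u ++ s) = (g.act s).map (fun t => u ++ t) := by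
  induction u with
  | nil => simp [actAt]
  | cons a u ih => simp [actAt, ih, Function.comp_def]

theorem run_tops (n : ℕ) :
    run ((List.range n).map (fun i => (i, Piece.top true))) [] =
      some (List.replicate n true ++ List.replicate n false) := by
  induction n with
  | zero => rfl
  | succ n ih =>
    have h := actAt_append (List.replicate n true) (.top true) (List.replicate n false)
    rw [List.length_replicate] at h
    rw [List.range_succ, List.map_append, run_append, ih]
    simp [run, h, Piece.act, List.replicate_succ' (n := n) (a := true),
      List.replicate_succ (n := n) (a := false)]

theorem run_bots (n : ℕ) :
    run ((List.range n).reverse.map (fun i => (i, Piece.bot)))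
      (List.replicate n true ++ List.replicate n false) = some [] := by
  induction n with
  | zero => rfl
  | succ n ih =>
    have h := actAt_append (List.replicate n true) .bot
      (true :: false :: List.replicate n false)
    rw [List.length_replicate] at h
    rw [List.range_succ, List.reverse_append, List.map_append, run_append,
      List.replicate_succ' (n := n) (a := true), List.replicate_succ (n := n) (a := false)]
    simpa [run, h, Piece.act] using ih

theorem actAt_cross {n : ℕ} (i : Fin (n - 1)) (k : Crossing) (s : List Bool) :
    actAt i.val (.cross k) (List.replicate n true ++ s) = some (List.replicate n true ++ s) := by
  obtain ⟨i, hi⟩ := i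
  obtain ⟨m, rfl⟩ : ∃ m, n = i + (m + 2) := ⟨n - 2 - i, by omega⟩
  have h := actAt_append (List.replicate i true) (.cross k)
    (List.replicate (m + 2) true ++ s)
  rw [List.length_replicate] at h
  rw [List.replicate_add, List.append_assoc, h]
  simp [Piece.act, List.replicate_succ]

theorem run_word {n : ℕ} (w : List (Letter n)) (s : List Bool) :
    run (w.map Letter.layer) (List.replicate n true ++ s) =
      some (List.replicate n true ++ s) := by
  induction w with
  | nil => rfl
  | cons l w ih => cases l <;> simpa [run, Letter.layer, actAt_cross] using ih

/-- The closure of a braid diagram. -/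
def braidClosure {n : ℕ} (w : List (Letter n)) : Diagram where
  layers := closureLayers w
  closed := by
    simp only [closureLayers, run_append, run_tops, run_word, run_bots, Option.bind_some]

/-- Every braid is represented by some braid diagram. -/
theorem exists_braidOf {n : ℕ} (α : UVB n) : ∃ w : List (Letter n), braidOf w = α := by
  have hr : ∀ i : Fin (n - 1), rho i * rho i = (1 : UVB n) := fun i => by
    have h : (QuotientGroup.mk (fr i * fr i * (1 : FreeGroup (Gen n))⁻¹) : UVB n) = 1 :=
      (QuotientGroup.eq_one_iff _).2 (Subgroup.subset_normalClosure ⟨_, _, .p3 i, rfl⟩)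
    rw [inv_one, mul_one] at h
    exact h
  have hm : ∀ v w : List (Letter n), braidOf (v ++ w) = braidOf v * braidOf w := fun v w => by
    simp [braidOf]
  have hα : α ∈ Subgroup.closure (Set.range (PresentedGroup.of (rels := braidRels n))) := by
    simp
  induction hα using Subgroup.closure_induction'' with
  | one => exact ⟨[], rfl⟩
  | mem x hx =>
    obtain ⟨g, rfl⟩ := hx
    cases g with
    | sigma i => exact ⟨[.sigma i], by simp [braidOf, Letter.toUVB, sigma]⟩
    | rho i => exact ⟨[.rho i], by simp [braidOf, Letter.toUVB, rho]⟩
  | inv_mem x hx =>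
    obtain ⟨g, rfl⟩ := hx
    cases g with
    | sigma i => exact ⟨[.sigmaInv i], by simp [braidOf, Letter.toUVB, sigma]⟩
    | rho i =>
      refine ⟨[.rho i], ?_⟩
      simp only [braidOf, Letter.toUVB, List.map_cons, List.map_nil, List.prod_cons, List.prod_nil,
        mul_one]
      exact eq_inv_of_mul_eq_one_left (hr i)
  | mul x y _ _ hx hy =>
    obtain ⟨v, rfl⟩ := hx
    obtain ⟨w, rfl⟩ := hy
    exact ⟨v ++ w, hm v w⟩

/-- The closures of the braids `α` and `β` are equivalent fused links: the closures of any braid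
diagrams that represent them are equivalent. -/
def ClosuresEquivalent {m n : ℕ} (α : UVB m) (β : UVB n) : Prop :=
  ∀ (a : List (Letter m)) (b : List (Letter n)), braidOf a = α → braidOf b = β →
    FusedEquivalent (braidClosure a) (braidClosure b)

end FusedLinks

namespace FusedLinks

/-! Call two braids interchangeable if either can replace the other as a factor of any braid without
changing the closure up to fused equivalence. Closures are invariant under conjugation, so this is a
congruence (`factorCon`). In the quotient group it is enough that the images of $\lambda_{n-1,n}$
and $\lambda_{n,n-1}$ commute: then every commutator $[u,v]$ becomes trivial. So the claim reduces
to `lamUp_mul_lamDown_equiv`.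

Label the last two strands 1, 2 and add strands 3, 4 by virtual stabilization. Write $(ab)$ for the
virtual transposition of $a$ and $b$; conjugation by it permutes the indices of the $\lambda_{cd}$.
The forbidden relations make $\lambda_{12}$ and $\lambda_{23}$ commute (`lamUp_commute_succ`), hence
also $\lambda_{21}$ and $\lambda_{13}$. Therefore
$\beta\lambda_{12}\lambda_{21}\sim\beta\lambda_{12}(23)\lambda_{21}=\beta(23)\lambda_{21}\lambda_{13}\sim\beta(23)\lambda_{21}(14)\lambda_{13}$
and
$\beta\lambda_{21}\lambda_{12}\sim\beta\lambda_{21}(13)\lambda_{12}=\beta(13)\lambda_{12}\lambda_{23}\sim\beta(13)\lambda_{12}(24)\lambda_{23}$.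
The two results are conjugate by $(34)$, which commutes with $\beta$ (`conj_four`).

The topological input is a Markov-type statement: the closure depends only on the braid
(`braidClosure_congr`), is invariant under cyclic permutation (`braidClosure_append_comm`), and does
not change under virtual stabilization (`braidClosure_stabilize`). -/

/-! ### Local replacement of layers inside a diagram. -/

/-- Two stacks of layers, placed below the level `s`, give equivalent diagrams. -/
def LEq (s : List Bool) (X Y : List Layer) : Prop :=
  run X s = run Y s ∧ ∀ (A B : List Layer) (hX : run (A ++ X ++ B) [] = some [])
    (hY : run (A ++ Y ++ B) [] = some []), run A [] = some s →
      FusedEquivalent ⟨A ++ X ++ B, hX⟩ ⟨A ++ Y ++ B, hY⟩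

theorem LEq.refl (s : List Bool) (X : List Layer) : LEq s X X :=
  ⟨rfl, fun _ _ _ _ _ => Relation.EqvGen.refl _⟩

theorem LEq.symm {s : List Bool} {X Y : List Layer} (h : LEq s X Y) : LEq s Y X :=
  ⟨h.1.symm, fun A B hX hY hA => (h.2 A B hY hX hA).symm⟩

theorem LEq.trans {s : List Bool} {X Y Z : List Layer} (h : LEq s X Y) (h' : LEq s Y Z) :
    LEq s X Z := by
  refine ⟨h.1.trans h'.1, fun A B hX hZ hA => ?_⟩
  -- The intermediate stack must itself be a closed diagram; this is why `LEq` also asks for equal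
  -- resulting levels.
  have hY : run (A ++ Y ++ B) [] = some [] := by
    rw [← hX]
    simp only [run_append, hA, Option.bind_some, h.1]
  exact (h.2 A B hX hY hA).trans _ _ _ (h'.2 A B hY hZ hA)

theorem LEq.append_right {s : List Bool} {X Y : List Layer} (h : LEq s X Y) (Q : List Layer) :
    LEq s (X ++ Q) (Y ++ Q) := by
  refine ⟨by simp only [run_append, h.1], fun A B => ?_⟩
  simp only [← List.append_assoc A, List.append_assoc _ Q B]
  exact h.2 A (Q ++ B)

theorem LEq.append_left {s : List Bool} {X Y : List Layer} (P : List Layer)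
    (h : ∀ t, run P s = some t → LEq t X Y) : LEq s (P ++ X) (P ++ Y) := by
  cases hP : run P s with
  -- If `P` does not fit below `s`, no diagram contains it there and the claim is vacuous.
  | none =>
    refine ⟨by simp [run_append, hP], fun A B hX _ hA => ?_⟩
    simp [run_append, hA, hP] at hX
  | some t =>
    refine ⟨by simp [run_append, hP, (h t hP).1], fun A B => ?_⟩
    simp only [← List.append_assoc A]
    exact fun hX hY hA => (h t hP).2 (A ++ P) B hX hY (by simp [run_append, hA, hP])

theorem LEq.cons {s : List Bool} {X Y : List Layer} (l : Layer) (h : ∀ t, LEq t X Y) :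
    LEq s (l :: X) (l :: Y) :=
  LEq.append_left [l] fun t _ => h t

theorem LEq.of_move {s : List Bool} {X Y : List Layer}
    (h : PlanarMove X Y ∨ ReidemeisterMove X Y) (hr : run X s = run Y s) : LEq s X Y :=
  ⟨hr, fun A B _ _ _ => Relation.EqvGen.rel _ _ ⟨A, X, Y, B, h, rfl, rfl⟩⟩

/-- A stack of layers shifted by one strand to the right. -/
theorem run_shift (L : List Layer) (a : Bool) (s : List Bool) :
    run (L.map fun l => (l.1 + 1, l.2)) (a :: s) = (run L s).map (a :: ·) := by
  induction L generalizing s with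
  | nil => rfl
  | cons l L ih =>
    simp only [List.map_cons, run, actAt]
    cases actAt l.1 l.2 s with
    | none => rfl
    | some t => exact ih t

/-- Both sides fail on the same levels, so the move applies below any level. Shifting by one strand
reduces the claim to `p = 0`. -/
theorem run_exchange (p r : ℕ) (g h : Piece) (s : List Bool) :
    run [(p, g), (p + g.outArity + r, h)] s = run [(p + g.inArity + r, h), (p, g)] s := by
  induction p generalizing s with
  | zero =>
    have e : ∀ t, actAt (2 + r) h t = actAt (r + 1 + 1) h t := fun t => by rw [add_comm]
    cases g with
    | top o =>
      cases hs : actAt r h s <;> simp [run, actAt, Piece.act, Piece.outArity, Piece.inArity, e, hs]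
    | bot =>
      rcases s with _ | ⟨a, _ | ⟨b, s⟩⟩
      · simp [run, actAt, Piece.act, Piece.inArity, e]
      · simp [run, actAt, Piece.act, Piece.inArity, e]
      · by_cases hb : b = !a <;> cases hs : actAt r h s <;>
        simp [run, actAt, Piece.act, Piece.outArity, Piece.inArity, e, hb, hs]
    | cross k =>
      rcases s with _ | ⟨a, _ | ⟨b, s⟩⟩
      · simp [run, actAt, Piece.act, Piece.inArity, e]
      · simp [run, actAt, Piece.act, Piece.inArity, e]
      · cases hs : actAt r h s <;>
        simp [run, actAt, Piece.act, Piece.outArity, Piece.inArity, e, hs]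
  | succ p ih =>
    have e1 : p + 1 + g.outArity + r = p + g.outArity + r + 1 := by omega
    have e2 : p + 1 + g.inArity + r = p + g.inArity + r + 1 := by omega
    rw [e1, e2]
    cases s with
    | nil => simp [run, actAt]
    | cons a s =>
      have h1 := run_shift [(p, g), (p + g.outArity + r, h)] a s
      have h2 := run_shift [(p + g.inArity + r, h), (p, g)] a s
      exact h1.trans ((congrArg _ (ih s)).trans h2.symm)

theorem run_pitchforkBot (p : ℕ) (k k' : Crossing) (s : List Bool) :
    run [(p, .cross k), (p + 1, .bot)] s = run [(p + 1, .cross k'), (p, .bot)] s := by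
  induction p generalizing s with
  | zero =>
    rcases s with _ | ⟨a, _ | ⟨b, _ | ⟨c, s⟩⟩⟩ <;> simp [run, actAt, Piece.act]
  | succ p ih =>
    cases s with
    | nil => simp [run, actAt]
    | cons a s =>
      have h1 := run_shift [(p, .cross k), (p + 1, .bot)] a s
      have h2 := run_shift [(p + 1, .cross k'), (p, .bot)] a s
      exact h1.trans ((congrArg _ (ih s)).trans h2.symm)

theorem run_pitchforkTop (p : ℕ) (o : Bool) (k k' : Crossing) (s : List Bool) :
    run [(p, .top o), (p + 1, .cross k)] s = run [(p + 1, .top o), (p, .cross k')] s := by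
  induction p generalizing s with
  | zero => rcases s with _ | ⟨a, s⟩ <;> simp [run, actAt, Piece.act]
  | succ p ih =>
    cases s with
    | nil => simp [run, actAt]
    | cons a s =>
      have h1 := run_shift [(p, .top o), (p + 1, .cross k)] a s
      have h2 := run_shift [(p + 1, .top o), (p, .cross k')] a s
      exact h1.trans ((congrArg _ (ih s)).trans h2.symm)

theorem run_three (p : ℕ) (a b c a' b' c' : Crossing) (s : List Bool) :
    run [(p, .cross a), (p + 1, .cross b), (p, .cross c)] s =
      run [(p + 1, .cross c'), (p, .cross b'), (p + 1, .cross a')] s := by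
  induction p generalizing s with
  | zero => rcases s with _ | ⟨x, _ | ⟨y, _ | ⟨z, s⟩⟩⟩ <;> simp [run, actAt, Piece.act]
  | succ p ih =>
    cases s with
    | nil => simp [run, actAt]
    | cons x s =>
      have h1 := run_shift [(p, .cross a), (p + 1, .cross b), (p, .cross c)] x s
      have h2 := run_shift [(p + 1, .cross c'), (p, .cross b'), (p + 1, .cross a')] x s
      exact h1.trans ((congrArg _ (ih s)).trans h2.symm)

theorem LEq.exchange {p q q' : ℕ} (r : ℕ) (g h : Piece) (hq : q = p + g.outArity + r)
    (hq' : q' = p + g.inArity + r) (s : List Bool) :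
    LEq s [(p, g), (q, h)] [(q', h), (p, g)] := by
  subst hq hq'
  exact .of_move (.inl (.exchange p r g h)) (run_exchange p r g h s)

theorem LEq.pitchforkBot (p : ℕ) (k : Crossing) (s : List Bool) :
    LEq s [(p, .cross k), (p + 1, .bot)] [(p + 1, .cross k.flip), (p, .bot)] :=
  .of_move (.inl (.pitchforkBot p k)) (run_pitchforkBot ..)

theorem LEq.pitchforkTop (p : ℕ) (o : Bool) (k : Crossing) (s : List Bool) :
    LEq s [(p, .top o), (p + 1, .cross k)] [(p + 1, .top o), (p, .cross k.flip)] :=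
  .of_move (.inl (.pitchforkTop p o k)) (run_pitchforkTop ..)

theorem LEq.three {a b c : Crossing} (p : ℕ) (h : TriangleMove a b c) (s : List Bool) :
    LEq s [(p, .cross a), (p + 1, .cross b), (p, .cross c)]
      [(p + 1, .cross c), (p, .cross b), (p + 1, .cross a)] :=
  .of_move (.inr (.three p a b c h)) (run_three ..)

theorem Crossing.flip_flip (k : Crossing) : k.flip.flip = k := by
  cases k <;> rfl

/-! ### Sliding a double point along the arcs of a closure -/

/-- The maxima of the closure of a braid. -/
def tops (n : ℕ) : List Layer := (List.range n).map fun i => (i, Piece.top true)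

/-- The minima of the closure of a braid. -/
def bots (n : ℕ) : List Layer := (List.range n).reverse.map fun i => (i, Piece.bot)

theorem tops_succ (n : ℕ) : tops (n + 1) = tops n ++ [(n, Piece.top true)] := by
  simp [tops, List.range_succ]

theorem bots_succ (n : ℕ) : bots (n + 1) = (n, Piece.bot) :: bots n := by
  simp [bots, List.range_succ]

/-- A double point on the arcs at positions `i`, `i + 1` travels through their minima to the
returning ends of the same two arcs, which are mirrored about the middle of the `2 * n` ends. Inner
arcs lie strictly between the two places and are passed by exchanging heights. -/
theorem bots_slide (k : Crossing) (n i j : ℕ) (hi : i + 1 < n) (hj : i + j + 2 = 2 * n)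
    (s : List Bool) : LEq s ((i, .cross k) :: bots n) ((j, .cross k) :: bots n) := by
  induction n generalizing j s with
  | zero => omega
  | succ n ih =>
    rcases Nat.lt_or_ge (i + 1) n with h | h
    · rw [bots_succ]
      refine ((LEq.exchange (q' := n) (n - 2 - i) (.cross k) .bot
        (by simp only [Piece.outArity]; omega) (by simp only [Piece.inArity]; omega)
        s).append_right (bots n)).trans ?_
      refine (LEq.cons (n, .bot) fun t => ih (j - 2) h (by omega) t).trans ?_
      exact (LEq.exchange (n - 2 - i) .bot (.cross k) (by simp only [Piece.outArity]; omega)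
        (by simp only [Piece.inArity]; omega) s).append_right (bots n)
    -- The two innermost arcs: one pitchfork move per minimum, with an exchange of the two minima in
    -- between. The crossing is flipped twice and so recovers its type.
    · obtain rfl : n = i + 1 := by omega
      obtain rfl : j = i + 2 := by omega
      rw [bots_succ, bots_succ]
      refine ((LEq.pitchforkBot i k s).append_right ((i, .bot) :: bots i)).trans ?_
      refine (LEq.cons (i + 1, .cross k.flip) fun t =>
        (LEq.exchange (q' := i + 2) 0 .bot .bot rfl rfl t).append_right (bots i)).trans ?_
      have h := (LEq.pitchforkBot (i + 1) k.flip s).append_right ((i, .bot) :: bots i)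
      rwa [Crossing.flip_flip] at h

theorem tops_slide (k : Crossing) (n i j : ℕ) (hi : i + 1 < n) (hj : i + j + 2 = 2 * n)
    (s : List Bool) : LEq s (tops n ++ [(i, .cross k)]) (tops n ++ [(j, .cross k)]) := by
  induction n generalizing j s with
  | zero => omega
  | succ n ih =>
    rcases Nat.lt_or_ge (i + 1) n with h | h
    · rw [tops_succ, List.append_assoc, List.append_assoc]
      refine (LEq.append_left (tops n) fun t _ => (LEq.exchange (q := n) (n - 2 - i) (.cross k)
        (.top true) (by simp only [Piece.outArity]; omega)
        (by simp only [Piece.inArity]; omega) t).symm).trans ?_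
      have := (ih (j - 2) h (by omega) s).append_right [(n, .top true)]
      rw [List.append_assoc, List.append_assoc] at this
      refine this.trans ?_
      exact LEq.append_left (tops n) fun t _ => (LEq.exchange (n - 2 - i) (.top true) (.cross k)
        (by simp only [Piece.outArity]; omega) (by simp only [Piece.inArity]; omega) t).symm
    · obtain rfl : n = i + 1 := by omega
      obtain rfl : j = i + 2 := by omega
      rw [tops_succ, tops_succ]
      simp only [List.append_assoc, List.cons_append, List.nil_append]
      refine LEq.append_left (tops i) fun t _ => ?_
      have h := LEq.pitchforkTop i true k.flip
      rw [Crossing.flip_flip] at h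
      refine (LEq.cons (i, .top true) fun t => (h t).symm).trans ?_
      refine ((LEq.exchange (q := i + 2) 0 (.top true) (.top true) rfl rfl t).symm.append_right
        [(i + 1, .cross k.flip)]).trans ?_
      exact LEq.cons (i, .top true) fun t => (LEq.pitchforkTop (i + 1) true k t).symm

theorem word_slide {n : ℕ} (w : List (Letter n)) (k : Crossing) (j : ℕ) (hj : n ≤ j)
    (s : List Bool) :
    LEq s ((j, .cross k) :: w.map Letter.layer) (w.map Letter.layer ++ [(j, .cross k)]) := by
  induction w generalizing s with
  | nil => exact LEq.refl _ _
  | cons l w ih =>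
    have key : ∀ (i : Fin (n - 1)) (c : Crossing),
        LEq s [(j, .cross k), (i.val, .cross c)] [(i.val, .cross c), (j, .cross k)] :=
      fun i c => (LEq.exchange (j - 2 - i) (.cross c) (.cross k)
        (by simp only [Piece.outArity]; omega) (by simp only [Piece.inArity]; omega) s).symm
    have hl : LEq s [(j, .cross k), l.layer] [l.layer, (j, .cross k)] := by
      cases l <;> exact key _ _
    exact (hl.append_right (w.map Letter.layer)).trans (LEq.cons l.layer fun t => ih t)

theorem word_slide_top {n : ℕ} (w : List (Letter n)) (s : List Bool) :
    LEq s ((n, .top true) :: w.map Letter.layer) (w.map Letter.layer ++ [(n, .top true)]) := by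
  induction w generalizing s with
  | nil => exact LEq.refl _ _
  | cons l w ih =>
    have key : ∀ (i : Fin (n - 1)) (c : Crossing),
        LEq s [(n, .top true), (i.val, .cross c)] [(i.val, .cross c), (n, .top true)] :=
      fun i c => (LEq.exchange (n - 2 - i) (.cross c) (.top true)
        (by simp only [Piece.outArity]; omega) (by simp only [Piece.inArity]; omega) s).symm
    have hl : LEq s [(n, .top true), l.layer] [l.layer, (n, .top true)] := by
      cases l <;> exact key _ _
    exact (hl.append_right (w.map Letter.layer)).trans (LEq.cons l.layer fun t => ih t)

theorem LEq.fusedEquivalent {D E : Diagram} (h : LEq [] D.layers E.layers) :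
    FusedEquivalent D E := by
  obtain ⟨D, hD⟩ := D
  obtain ⟨E, hE⟩ := E
  simpa using h.2 [] [] (by simpa using hD) (by simpa using hE) rfl

theorem closureLayers_eq {n : ℕ} (w : List (Letter n)) :
    closureLayers w = tops n ++ (w.map Letter.layer ++ bots n) := by
  simp [closureLayers, tops, bots]

/-- The first crossing goes up over the maxima to the returning strands, down along the right of the
word, and back through the minima to the bottom of the braid. -/
theorem braidClosure_cons {n : ℕ} (l : Letter n) (w : List (Letter n)) :
    FusedEquivalent (braidClosure (l :: w)) (braidClosure (w ++ [l])) := by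
  have key : ∀ (i : Fin (n - 1)) (c : Crossing), LEq []
      (tops n ++ ((i.val, .cross c) :: w.map Letter.layer ++ bots n))
      (tops n ++ (w.map Letter.layer ++ (i.val, .cross c) :: bots n)) := by
    intro i c
    have h1 := (tops_slide c n i (2 * n - 2 - i) (by omega) (by omega) []).append_right
      (w.map Letter.layer ++ bots n)
    simp only [List.append_assoc, List.cons_append, List.nil_append] at h1 ⊢
    refine h1.trans (LEq.append_left _ fun t _ => ?_)
    have h2 := (word_slide w c (2 * n - 2 - i) (by omega) t).append_right (bots n)
    simp only [List.append_assoc, List.cons_append, List.nil_append] at h2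
    exact h2.trans (LEq.append_left _ fun t _ =>
      (bots_slide c n i (2 * n - 2 - i) (by omega) (by omega) t).symm)
  apply LEq.fusedEquivalent
  show LEq [] (closureLayers _) (closureLayers _)
  rw [closureLayers_eq, closureLayers_eq, List.map_append, List.append_assoc]
  cases l <;> exact key _ _

theorem braidClosure_append_comm {n : ℕ} (v w : List (Letter n)) :
    FusedEquivalent (braidClosure (v ++ w)) (braidClosure (w ++ v)) := by
  induction v generalizing w with
  | nil => rw [List.append_nil]; exact Relation.EqvGen.refl _
  | cons l v ih =>
    have h := ih (w ++ [l])
    rw [List.append_assoc] at h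
    have h' := braidClosure_cons l (v ++ w)
    rw [List.append_assoc] at h'
    exact h'.trans _ _ _ h

/-! ### Virtual stabilization -/

/-- A letter on `n` strands, as a letter on one strand more. -/
def Letter.up {n : ℕ} : Letter n → Letter (n + 1)
  | .sigma i => .sigma ⟨i, by omega⟩
  | .sigmaInv i => .sigmaInv ⟨i, by omega⟩
  | .rho i => .rho ⟨i, by omega⟩

theorem Letter.layer_up {n : ℕ} (l : Letter n) : l.up.layer = l.layer := by
  cases l <;> rfl

/-- Creating a kink requires a strand to carry it, since the empty stack fits below every level.
Hence the level is taken to begin with `n + 1` strands. -/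
theorem run_kink (n : ℕ) (k : Crossing) (s : List Bool) :
    run [(n + 1, .top true), (n, .cross k), (n + 1, .bot)] (List.replicate (n + 1) true ++ s) =
      some (List.replicate (n + 1) true ++ s) := by
  induction n with
  | zero => simp [run, actAt, Piece.act]
  | succ n ih =>
    have h := run_shift [(n + 1, .top true), (n, .cross k), (n + 1, .bot)] true
      (List.replicate (n + 1) true ++ s)
    exact h.trans (congrArg _ ih)

/-- The new strand closes up innermost. Once its maximum is slid below the word, it forms with the
virtual crossing and the new minimum a virtual kink on the last old strand. -/
theorem braidClosure_stabilize {n : ℕ} (hn : 0 < n) (w : List (Letter n)) :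
    FusedEquivalent (braidClosure w)
      (braidClosure (w.map Letter.up ++ [Letter.rho ⟨n - 1, by omega⟩])) := by
  obtain ⟨n, rfl⟩ : ∃ m, n = m + 1 := ⟨n - 1, by omega⟩
  apply LEq.fusedEquivalent
  show LEq [] (closureLayers _) (closureLayers _)
  have e : (w.map Letter.up).map Letter.layer = w.map Letter.layer := by
    simp [Letter.layer_up]
  rw [closureLayers_eq, closureLayers_eq, List.map_append, e, tops_succ (n + 1), bots_succ (n + 1)]
  simp only [List.append_assoc]
  refine LEq.append_left _ fun t ht => ?_
  replace ht : t = List.replicate (n + 1) true ++ List.replicate (n + 1) false :=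
    Option.some_injective _ (ht.symm.trans (run_tops (n + 1)))
  have h := ((word_slide_top w t).append_right
    ([(n, .cross .virt), (n + 1, .bot)] ++ bots (n + 1)))
  simp only [List.append_assoc] at h
  refine LEq.trans ?_ h.symm
  refine LEq.append_left _ fun t' ht' => ?_
  obtain rfl : t' = t := by
    subst ht
    exact (Option.some_injective _ ((run_word w _).symm.trans ht')).symm
  subst ht
  exact ((LEq.of_move (.inr (.oneRight n true .virt)) (run_kink ..)).symm.append_right _)

/-! ### Words that represent the same braid -/

/-- This move deletes layers, so the level must be known to contain the two strands; the initial `n`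
strands guarantee it. -/
theorem LEq.two {n : ℕ} (i : Fin (n - 1)) (k k' : Crossing) (h : k' = k.flip) (s : List Bool) :
    LEq (List.replicate n true ++ s) [(i.val, .cross k), (i.val, .cross k')] [] := by
  subst h
  exact .of_move (.inr (.two i k)) (by simp [run, actAt_cross])

/-- Braid diagrams with equivalent stacks of layers, below any level that begins with `n` strands
running downwards. -/
def wordCon (n : ℕ) : Con (FreeMonoid (Letter n)) where
  r v w := ∀ s, LEq (List.replicate n true ++ s) (v.toList.map Letter.layer)
    (w.toList.map Letter.layer)
  iseqv := ⟨fun _ _ => LEq.refl _ _, fun h s => (h s).symm, fun h h' s => (h s).trans (h' s)⟩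
  mul' {v v' w w'} h h' s := by
    simp only [FreeMonoid.toList_mul, List.map_append]
    refine ((h s).append_right _).trans (LEq.append_left _ fun t ht => ?_)
    rw [run_word, Option.some_inj] at ht
    exact ht ▸ h' s

/-- The class of a letter. -/
def letterClass {n : ℕ} (l : Letter n) : (wordCon n).Quotient := (FreeMonoid.of l : FreeMonoid _)

theorem letterClass_mul_eq_one {n : ℕ} {l l' : Letter n}
    (h : ∀ s, LEq (List.replicate n true ++ s) [l.layer, l'.layer] []) :
    letterClass l * letterClass l' = 1 :=
  (Con.eq (wordCon n)).2 h

/-- The unit given by a generator. -/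
def genUnit {n : ℕ} : Gen n → (wordCon n).Quotientˣ
  | .sigma i =>
    ⟨letterClass (.sigma i), letterClass (.sigmaInv i),
      letterClass_mul_eq_one fun s => LEq.two i .over .under rfl s,
      letterClass_mul_eq_one fun s => LEq.two i .under .over rfl s⟩
  | .rho i =>
    ⟨letterClass (.rho i), letterClass (.rho i),
      letterClass_mul_eq_one fun s => LEq.two i .virt .virt rfl s,
      letterClass_mul_eq_one fun s => LEq.two i .virt .virt rfl s⟩

theorem LEq.far {m : ℕ} {i j : Fin m} (h : Far i j) (k k' : Crossing) (s : List Bool) :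
    LEq s [(i.val, .cross k), (j.val, .cross k')] [(j.val, .cross k'), (i.val, .cross k)] := by
  rcases h with h | h
  · exact LEq.exchange (j - 2 - i) (.cross k) (.cross k')
      (by simp only [Piece.outArity]; omega) (by simp only [Piece.inArity]; omega) s
  · exact (LEq.exchange (i - 2 - j) (.cross k') (.cross k)
      (by simp only [Piece.outArity]; omega) (by simp only [Piece.inArity]; omega) s).symm

theorem LEq.adjacent {a b c : Crossing} {m : ℕ} {i j : Fin m} (hij : i.val + 1 = j.val)
    (h : TriangleMove a b c) (s : List Bool) :
    LEq s [(i.val, .cross a), (j.val, .cross b), (i.val, .cross c)]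
      [(j.val, .cross c), (i.val, .cross b), (j.val, .cross a)] := by
  rw [← hij]
  exact LEq.three i h s

/-- Every defining relation is a single diagram move: a triangle move for neighbouring indices, an
exchange of heights for distant ones, a second move for `p3`. -/
theorem lift_genUnit {n : ℕ} {x y : FreeGroup (Gen n)} (h : BraidRel n x y) :
    FreeGroup.lift genUnit x = FreeGroup.lift genUnit y := by
  apply Units.ext
  cases h <;> simp only [fs, fr, map_mul, FreeGroup.lift_apply_of, map_one] <;>
    refine (Con.eq (wordCon n)).2 fun s => ?_
  case b1 i j h =>
    exact LEq.adjacent h (.classical .over .over .over trivial trivial trivial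
      (by simp [Crossing.flip])) _
  case b2 i j h => exact LEq.far h .over .over _
  case p1 i j h => exact LEq.adjacent h .virtual _
  case p2 i j h => exact LEq.far h .virt .virt _
  case p3 i => exact LEq.two i .virt .virt rfl s
  case m1 i j h => exact LEq.far h .over .virt _
  case m2 i j h => exact LEq.adjacent h (.mixed1 .over trivial) _
  case f1 i j h => exact LEq.adjacent h (.forbidden3 .over trivial) _
  case f2 i j h => exact (LEq.adjacent h (.forbidden1 .over trivial) _).symm

/-- The class of the braid diagrams that represent a braid. -/
def braidClass (n : ℕ) : UVB n →* (wordCon n).Quotientˣ :=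
  PresentedGroup.toGroup (f := genUnit) (rels := braidRels n) (by
    rintro _ ⟨x, y, h, rfl⟩
    rw [map_mul, map_inv, lift_genUnit h, mul_inv_cancel])

theorem braidClass_letter {n : ℕ} (l : Letter n) :
    (braidClass n l.toUVB : (wordCon n).Quotient) = letterClass l := by
  cases l with
  | sigma i => exact congrArg Units.val (PresentedGroup.toGroup.of _)
  | sigmaInv i =>
    rw [Letter.toUVB, map_inv]
    exact congrArg (fun u : (wordCon n).Quotientˣ => (u⁻¹).val) (PresentedGroup.toGroup.of _)
  | rho i => exact congrArg Units.val (PresentedGroup.toGroup.of _)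

theorem braidClass_braidOf {n : ℕ} (w : List (Letter n)) :
    (braidClass n (braidOf w) : (wordCon n).Quotient) = (FreeMonoid.ofList w : FreeMonoid _) := by
  induction w with
  | nil => simp [braidOf]
  | cons l w ih =>
    have h : braidOf (l :: w) = l.toUVB * braidOf w := rfl
    rw [h, map_mul, Units.val_mul, ih, braidClass_letter]
    rfl

/-- The class of a word modulo diagram moves factors through the group by `braidClass`, so words for
the same braid have the same class. -/
theorem braidClosure_congr {n : ℕ} {v w : List (Letter n)} (h : braidOf v = braidOf w) :
    FusedEquivalent (braidClosure v) (braidClosure w) := by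
  have e := braidClass_braidOf v
  rw [h, braidClass_braidOf] at e
  have e' := (Con.eq (wordCon n)).1 e.symm
  apply LEq.fusedEquivalent
  show LEq [] (closureLayers _) (closureLayers _)
  rw [closureLayers_eq, closureLayers_eq]
  refine LEq.append_left _ fun t ht => LEq.append_right ?_ _
  -- Below the maxima the level begins with `n` downward strands, which is where `wordCon` compares
  -- words.
  have ht' := Option.some_injective _ (ht.symm.trans (run_tops n))
  rw [ht']
  exact e' _

/-! ### Moves between braids with equivalent closures -/

theorem braidOf_append {n : ℕ} (v w : List (Letter n)) :
    braidOf (v ++ w) = braidOf v * braidOf w := by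
  simp [braidOf]

theorem ClosuresEquivalent.of_words {m n : ℕ} {v : List (Letter m)} {w : List (Letter n)}
    (h : FusedEquivalent (braidClosure v) (braidClosure w)) :
    ClosuresEquivalent (braidOf v) (braidOf w) := fun _ _ ha hb =>
  (braidClosure_congr ha).trans _ _ _ (h.trans _ _ _ (braidClosure_congr hb.symm))

theorem ClosuresEquivalent.refl {n : ℕ} (α : UVB n) : ClosuresEquivalent α α :=
  fun _ _ ha hb => braidClosure_congr (ha.trans hb.symm)

theorem ClosuresEquivalent.symm {m n : ℕ} {α : UVB m} {β : UVB n} (h : ClosuresEquivalent α β) :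
    ClosuresEquivalent β α := fun a b ha hb => (h b a hb ha).symm

theorem ClosuresEquivalent.trans {l m n : ℕ} {α : UVB l} {β : UVB m} {γ : UVB n}
    (h : ClosuresEquivalent α β) (h' : ClosuresEquivalent β γ) : ClosuresEquivalent α γ := by
  obtain ⟨w, hw⟩ := exists_braidOf β
  exact fun a b ha hb => (h a w ha hw).trans _ _ _ (h' w b hw hb)

theorem ClosuresEquivalent.mul_comm {n : ℕ} (α β : UVB n) :
    ClosuresEquivalent (α * β) (β * α) := by
  obtain ⟨v, rfl⟩ := exists_braidOf α
  obtain ⟨w, rfl⟩ := exists_braidOf β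
  rw [← braidOf_append, ← braidOf_append]
  exact .of_words (braidClosure_append_comm v w)

theorem ClosuresEquivalent.conj {n : ℕ} (α β : UVB n) :
    ClosuresEquivalent α (β * α * β⁻¹) := by
  have h := ClosuresEquivalent.mul_comm β⁻¹ (β * α)
  rwa [inv_mul_cancel_left] at h

theorem eq_of_braidRel {n : ℕ} {x y : FreeGroup (Gen n)} (h : BraidRel n x y) :
    (PresentedGroup.mk (braidRels n) x) = PresentedGroup.mk (braidRels n) y := by
  apply eq_of_mul_inv_eq_one
  rw [← map_inv, ← map_mul]
  exact (QuotientGroup.eq_one_iff _).2 (Subgroup.subset_normalClosure ⟨_, _, h, rfl⟩)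

/-- The generators of `UVB n`, read in `UVB (n + 1)`. -/
def genUp {n : ℕ} : Gen n → UVB (n + 1)
  | .sigma i => sigma ⟨i, by omega⟩
  | .rho i => rho ⟨i, by omega⟩

/-- The inclusion of braids that adds a trivial strand on the right. -/
def up (n : ℕ) : UVB n →* UVB (n + 1) :=
  PresentedGroup.toGroup (f := genUp) (rels := braidRels n) (by
    rintro _ ⟨x, y, h, rfl⟩
    rw [map_mul, map_inv, mul_inv_eq_one]
    cases h <;> simp only [fs, fr, map_mul, FreeGroup.lift_apply_of, map_one, genUp]
    case b1 h => exact eq_of_braidRel (.b1 _ _ h)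
    case b2 h => exact eq_of_braidRel (.b2 _ _ h)
    case p1 h => exact eq_of_braidRel (.p1 _ _ h)
    case p2 h => exact eq_of_braidRel (.p2 _ _ h)
    case p3 => exact eq_of_braidRel (.p3 _)
    case m1 h => exact eq_of_braidRel (.m1 _ _ h)
    case m2 h => exact eq_of_braidRel (.m2 _ _ h)
    case f1 h => exact eq_of_braidRel (.f1 _ _ h)
    case f2 h => exact eq_of_braidRel (.f2 _ _ h))

theorem up_sigma {n : ℕ} (i : Fin (n - 1)) : up n (sigma i) = sigma ⟨i, by omega⟩ :=
  PresentedGroup.toGroup.of _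

theorem up_rho {n : ℕ} (i : Fin (n - 1)) : up n (rho i) = rho ⟨i, by omega⟩ :=
  PresentedGroup.toGroup.of _

theorem braidOf_up {n : ℕ} (w : List (Letter n)) : braidOf (w.map Letter.up) = up n (braidOf w) := by
  induction w with
  | nil => simp [braidOf]
  | cons l w ih =>
    have h : braidOf (l :: w) = l.toUVB * braidOf w := rfl
    have h' : braidOf ((l :: w).map Letter.up) = l.up.toUVB * braidOf (w.map Letter.up) := rfl
    rw [h, h', ih, map_mul]
    congr 1
    cases l <;> simp [Letter.up, Letter.toUVB, up_sigma, up_rho]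

theorem ClosuresEquivalent.stabilize {n : ℕ} (hn : 0 < n) (α : UVB n) :
    ClosuresEquivalent α (up n α * rho ⟨n - 1, by omega⟩) := by
  obtain ⟨w, rfl⟩ := exists_braidOf α
  have h := ClosuresEquivalent.of_words (braidClosure_stabilize hn w)
  rw [braidOf_append, braidOf_up] at h
  simpa [braidOf, Letter.toUVB] using h

/-- Stabilization inside a product, along any strand. -/
theorem ClosuresEquivalent.stabilize_mul {n : ℕ} (hn : 0 < n) (α β p : UVB n) :
    ClosuresEquivalent (α * β)
      (up n α * (up n p * rho ⟨n - 1, by omega⟩ * (up n p)⁻¹) * up n β) := by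
  have h1 := (ClosuresEquivalent.mul_comm α β).trans (ClosuresEquivalent.conj (β * α) p⁻¹)
  have h2 := h1.trans (ClosuresEquivalent.stabilize hn _)
  -- Stabilization puts the new transposition at the end of `p⁻¹ * β * α * p`; this conjugation
  -- moves it, conjugated by `p`, between `α` and `β`.
  have h3 := h2.trans (ClosuresEquivalent.conj _ ((up n β)⁻¹ * up n p))
  convert h3 using 1
  simp only [map_mul, map_inv]
  group

theorem rho_mul_self {n : ℕ} (i : Fin (n - 1)) : rho i * rho i = (1 : UVB n) :=
  eq_of_braidRel (.p3 i)

/-- The index `n` is that of the virtual crossing of exactly the two added strands, so it is far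
from every generator coming from `n` strands. -/
theorem up_up_commute_rho {n : ℕ} (β : UVB n) (k : Fin (n + 2 - 1)) (hk : k.val = n) :
    Commute (up (n + 1) (up n β)) (rho k) := by
  suffices h : ⊤ ≤ (Subgroup.centralizer {rho k}).comap ((up (n + 1)).comp (up n)) by
    exact Subgroup.mem_centralizer_singleton_iff.1 (h (Subgroup.mem_top β))
  rw [← PresentedGroup.closure_range_of (braidRels n), Subgroup.closure_le]
  rintro _ ⟨g, rfl⟩
  refine Subgroup.mem_centralizer_singleton_iff.2 ?_
  cases g with
  | sigma i =>
    have := up_sigma (n := n + 1) ⟨i.val, by omega⟩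
    rw [MonoidHom.comp_apply, ← sigma, up_sigma, this]
    exact eq_of_braidRel (.m1 ⟨i.val, _⟩ k (Or.inl (by change i.val + 2 ≤ k.val; omega)))
  | rho i =>
    have := up_rho (n := n + 1) ⟨i.val, by omega⟩
    rw [MonoidHom.comp_apply, ← rho, up_rho, this]
    exact eq_of_braidRel (.p2 ⟨i.val, _⟩ k (Or.inl (by change i.val + 2 ≤ k.val; omega)))

/-! ### Relations between the generators of the pure group -/

/-- Here $x=\lambda_{12}$, $y=\lambda_{23}$ and $p=txt=\lambda_{13}$. With the virtual letters moved
to the left and cancelled, `f1` says that $p$ commutes with $y$, `f2` that $p$ commutes with $x$,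
and `b` that $ypx=xpy$. Cancelling $p$ in the last equation leaves $yx=xy$. -/
theorem commute_of_forbidden {G : Type*} [Group G] {r t x y : G} (hr : r * r = 1) (ht : t * t = 1)
    (hrt : r * t * r = t * r * t) (hxy : x * t * r = t * r * y)
    (f1 : r * x * (t * y) * r = t * (r * x) * (t * y))
    (f2 : t * y * (r * x) * t = r * (t * y) * (r * x))
    (b : r * x * (t * y) * (r * x) = t * y * (r * x) * (t * y)) : Commute x y := by
  obtain ⟨p, hp⟩ : ∃ p, p = t * x * t := ⟨_, rfl⟩
  have xt : x * t = t * p := by rw [hp]; simp only [← mul_assoc, ht, one_mul]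
  have pt : p * t = t * x := by rw [hp]; simp only [mul_assoc, ht, mul_one]
  have pr : p * r = r * y := by
    rw [xt, mul_assoc, mul_assoc] at hxy
    exact mul_left_cancel hxy
  have yr : y * r = r * p := by
    calc y * r = r * r * y * r := by rw [hr, one_mul]
      _ = r * (p * r) * r := by rw [pr]; group
      _ = r * p * (r * r) := by group
      _ = _ := by rw [hr, mul_one]
  have hyp : y * p = p * y := by
    have h1 : r * x * (t * y) * r = r * t * r * (y * p) := by
      calc r * x * (t * y) * r = r * (x * t) * (y * r) := by group
        _ = r * t * (p * r) * p := by rw [xt, yr]; group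
        _ = _ := by rw [pr]; group
    have h2 : t * (r * x) * (t * y) = r * t * r * (p * y) := by
      calc t * (r * x) * (t * y) = t * r * (x * t) * y := by group
        _ = (t * r * t) * (p * y) := by rw [xt]; group
        _ = _ := by rw [hrt]
    rw [h1, h2] at f1
    exact mul_left_cancel f1
  have hxp : x * p = p * x := by
    have h1 : t * y * (r * x) * t = r * t * r * (x * p) := by
      calc t * y * (r * x) * t = t * (y * r) * (x * t) := by group
        _ = t * r * (p * t) * p := by rw [xt, yr]; group
        _ = (t * r * t) * (x * p) := by rw [pt]; group
        _ = _ := by rw [hrt]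
    have h2 : r * (t * y) * (r * x) = r * t * r * (p * x) := by
      calc r * (t * y) * (r * x) = r * t * (y * r) * x := by group
        _ = _ := by rw [yr]; group
    rw [h1, h2] at f2
    exact mul_left_cancel f2
  have h1 : r * x * (t * y) * (r * x) = r * t * r * (y * p * x) := by
    calc r * x * (t * y) * (r * x) = r * (x * t) * (y * r) * x := by group
      _ = r * t * (p * r) * p * x := by rw [xt, yr]; group
      _ = _ := by rw [pr]; group
  have h2 : t * y * (r * x) * (t * y) = r * t * r * (x * p * y) := by
    calc t * y * (r * x) * (t * y) = t * (y * r) * (x * t) * y := by group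
      _ = t * r * (p * t) * p * y := by rw [xt, yr]; group
      _ = (t * r * t) * (x * p * y) := by rw [pt]; group
      _ = _ := by rw [hrt]
  rw [h1, h2] at b
  have h3 := mul_left_cancel b
  rw [hyp, hxp, mul_assoc, mul_assoc] at h3
  exact (mul_left_cancel h3).symm

theorem rho_braid {n : ℕ} {i j : Fin (n - 1)} (h : i.val + 1 = j.val) :
    rho i * rho j * rho i = rho j * rho i * rho j := eq_of_braidRel (.p1 i j h)

theorem sigma_inv_eq {n : ℕ} (i : Fin (n - 1)) : (sigma i)⁻¹ = rho i * lamUp i := by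
  rw [lamUp, ← mul_assoc, rho_mul_self, one_mul]

theorem rho_inv {n : ℕ} (i : Fin (n - 1)) : (rho i)⁻¹ = rho i :=
  inv_eq_of_mul_eq_one_left (rho_mul_self i)

theorem lamUp_mul_rho {n : ℕ} {i j : Fin (n - 1)} (h : i.val + 1 = j.val) :
    lamUp i * rho j * rho i = rho j * rho i * lamUp j := by
  have m : rho i * rho j * sigma i = sigma j * rho i * rho j := eq_of_braidRel (.m2 i j h)
  have m' : (sigma i)⁻¹ * rho j * rho i = rho j * rho i * (sigma j)⁻¹ := by
    have := congrArg (·⁻¹) m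
    simpa only [mul_inv_rev, rho_inv, mul_assoc] using this
  calc lamUp i * rho j * rho i = rho i * ((sigma i)⁻¹ * rho j * rho i) := by
        simp only [lamUp, mul_assoc]
    _ = rho i * rho j * rho i * (sigma j)⁻¹ := by rw [m']; simp only [mul_assoc]
    _ = _ := by rw [rho_braid h]; simp only [lamUp, mul_assoc]

/-- Since $\sigma_i^{-1}=\rho_i\lambda_{i,i+1}$, the inverted forbidden and braid relations are the
hypotheses of `commute_of_forbidden`. -/
theorem lamUp_commute_succ {n : ℕ} {i j : Fin (n - 1)} (h : i.val + 1 = j.val) :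
    Commute (lamUp i) (lamUp j) := by
  have f1 : rho i * sigma j * sigma i = sigma j * sigma i * rho j := eq_of_braidRel (.f1 i j h)
  have f2 : rho j * sigma i * sigma j = sigma i * sigma j * rho i := eq_of_braidRel (.f2 i j h)
  have b : sigma i * sigma j * sigma i = sigma j * sigma i * sigma j :=
    eq_of_braidRel (.b1 i j h)
  apply commute_of_forbidden (rho_mul_self i) (rho_mul_self j) (rho_braid h) (lamUp_mul_rho h)
  · have := congrArg (·⁻¹) f1
    simpa only [mul_inv_rev, rho_inv, ← sigma_inv_eq, mul_assoc] using this
  · have := congrArg (·⁻¹) f2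
    simpa only [mul_inv_rev, rho_inv, ← sigma_inv_eq, mul_assoc] using this
  · have := congrArg (·⁻¹) b
    simpa only [mul_inv_rev, rho_inv, ← sigma_inv_eq, mul_assoc] using this

theorem lamUp_commute_rho {n : ℕ} {i j : Fin (n - 1)} (h : Far i j) :
    Commute (lamUp i) (rho j) := by
  have h1 : Commute (rho i) (rho j) := eq_of_braidRel (.p2 i j h)
  have h2 : Commute (sigma i) (rho j) := eq_of_braidRel (.m1 i j h)
  exact h1.mul_left h2.inv_left

theorem lamUp_commute_far {n : ℕ} {i j : Fin (n - 1)} (h : Far i j) :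
    Commute (lamUp i) (lamUp j) := by
  have h1 : Commute (rho i) (sigma j) :=
    Commute.symm (eq_of_braidRel (.m1 j i (Or.symm h)))
  have h2 : Commute (sigma i) (sigma j) := eq_of_braidRel (.b2 i j h)
  exact (lamUp_commute_rho h).mul_right (h1.mul_left h2.inv_left).inv_right

theorem up_lamUp {n : ℕ} (i : Fin (n - 1)) : up n (lamUp i) = lamUp ⟨i, by omega⟩ := by
  simp only [lamUp, map_mul, map_inv, up_sigma, up_rho]

/-! ### Exchange of $\lambda_{n-1,n}$ and $\lambda_{n,n-1}$ by two virtual stabilizations. -/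

theorem conj_three {G : Type*} [Group G] {r t x y : G} (hr : r * r = 1) (ht : t * t = 1)
    (hxy : x * t * r = t * r * y) : t * x * t = r * y * r := by
  calc t * x * t = t * (x * t * r) * r := by simp only [mul_assoc, hr, mul_one]
    _ = (t * t) * r * y * r := by rw [hxy]; simp only [mul_assoc]
    _ = _ := by rw [ht, one_mul]

/-- Four strands `1, 2, 3, 4` with virtual transpositions `r, s, t` of neighbours and pure
generators `x, y, z` of neighbours: exchanging the roles of the strands `3` and `4`. -/
theorem conj_four {G : Type*} [Group G] {r s t x y z b : G} (hr : r * r = 1) (hs : s * s = 1)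
    (ht : t * t = 1) (hrs : r * s * r = s * r * s) (hst : s * t * s = t * s * t)
    (hrt : r * t = t * r) (hxy : x * s * r = s * r * y) (hyz : y * t * s = t * s * z)
    (hxt : x * t = t * x) (hxz : x * z = z * x) (hb : b * t = t * b) :
    t * (b * s * (r * x * r) * (r * s * r * t * (r * s * r)) * (s * x * s)) * t =
      b * (r * s * r) * x * (s * t * s) * y := by
  have e1 : s * x * s = r * y * r := conj_three hr hs hxy
  have e2 : t * y * t = s * z * s := conj_three hs ht hyz
  -- These are $\lambda_{14}$ and $\lambda_{23}$; conjugation by $ts$ obtains them from the distant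
  -- pair $\lambda_{12}$, $\lambda_{34}$.
  have c : Commute (t * s * x * s * t) y := by
    have hy : y = t * s * z * s * t := by
      calc y = (t * t) * y * (t * t) := by rw [ht]; group
        _ = t * (t * y * t) * t := by group
        _ = _ := by rw [e2]; group
    have : y * (t * s * x * s * t) = t * s * x * s * t * y := by
      calc y * (t * s * x * s * t) = t * s * z * (s * (t * t) * s) * x * s * t := by
            rw [hy]; group
        _ = t * s * (x * z) * s * t := by rw [ht, hxz, mul_one, hs]; group
        _ = t * s * x * (s * (t * t) * s) * z * s * t := by rw [ht, mul_one, hs]; group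
        _ = _ := by rw [hy]; group
    exact this.symm
  have e3 : (r * x * r) * (r * s * r) = (r * s * r) * y := by
    calc (r * x * r) * (r * s * r) = r * x * (r * r) * s * r := by group
      _ = r * (x * s * r) := by rw [hr]; group
      _ = _ := by rw [hxy]; group
  -- Conjugation by $(34)$ turns $(14)$ into $(13)$.
  have e4 : t * (r * s * r * t * (r * s * r)) * t = r * s * r := by
    calc t * (r * s * r * t * (r * s * r)) * t = t * r * s * (r * t) * r * s * r * t := by group
      _ = t * r * s * t * (r * r) * s * r * t := by rw [hrt]; group
      _ = t * r * (s * t * s) * r * t := by rw [hr]; group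
      _ = (t * r) * t * s * t * (r * t) := by rw [hst]; group
      _ = t * r * t * s * (t * t) * r := by rw [hrt]; group
      _ = r * (t * t) * s * (t * t) * r := by rw [← hrt]; group
      _ = _ := by rw [ht]; group
  have hyt : (r * x * r) * t = t * (r * x * r) := by
    calc (r * x * r) * t = r * x * (r * t) := by group
      _ = r * (x * t) * r := by rw [hrt]; group
      _ = (r * t) * x * r := by rw [hxt]; group
      _ = _ := by rw [hrt]; group
  -- The disjoint transpositions $(24)$ and $(13)$ commute.
  have e5 : (s * t * s) * (r * s * r) = (r * s * r) * (s * t * s) := by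
    calc (s * t * s) * (r * s * r) = (s * t * s) * (s * r * s) := by rw [hrs]
      _ = s * t * (s * s) * r * s := by group
      _ = s * (t * r) * s := by rw [hs]; group
      _ = s * r * (s * s) * t * s := by rw [← hrt, hs]; group
      _ = (s * r * s) * (s * t * s) := by group
      _ = _ := by rw [hrs]
  calc t * (b * s * (r * x * r) * (r * s * r * t * (r * s * r)) * (s * x * s)) * t
      = (b * t) * s * (r * x * r) * (r * s * r * t * (r * s * r)) * (s * x * s) * t := by
        rw [hb]; group
    _ = b * t * s * ((t * t) * (r * x * r)) * (r * s * r * t * (r * s * r)) * ((t * t) *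
          (s * x * s)) * t := by rw [ht, one_mul, one_mul]
    _ = b * t * s * t * (t * (r * x * r)) * (r * s * r * t * (r * s * r)) * t * (t * s * x * s * t)
          := by group
    _ = b * (t * s * t) * (r * x * r) * (t * (r * s * r * t * (r * s * r)) * t) *
          (t * s * x * s * t) := by rw [← hyt]; group
    _ = b * (s * t * s) * ((r * x * r) * (r * s * r)) * (t * s * x * s * t) := by
        rw [e4, ← hst]; group
    _ = b * ((s * t * s) * (r * s * r)) * ((t * s * x * s * t) * y) := by
        rw [e3, c.eq]; group
    _ = b * (r * s * r) * (s * t * s) * (t * s * x * s * t) * y := by rw [e5]; group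
    _ = b * (r * s * r) * (t * s * t) * (t * s * x * s * t) * y := by rw [hst]
    _ = b * (r * s * r) * (t * s * (t * t) * s * x * s * t) * y := by group
    _ = b * (r * s * r) * (t * (s * s) * x * s * t) * y := by rw [ht]; group
    _ = b * (r * s * r) * (t * x * s * t) * y := by rw [hs]; group
    _ = b * (r * s * r) * (x * (t * s * t)) * y := by rw [← hxt]; group
    _ = _ := by rw [← hst]; group

/-- Conjugating the commuting pair $\lambda_{12}$, $\lambda_{23}$ by $(12)$ gives $\lambda_{21}$,
$\lambda_{13}$. -/
theorem commute_conj_three {G : Type*} [Group G] {r s x y : G} (hr : r * r = 1) (hs : s * s = 1)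
    (hxy : x * s * r = s * r * y) (hc : x * y = y * x) :
    (s * x * s) * (r * x * r) = (r * x * r) * (s * x * s) := by
  rw [conj_three hr hs hxy]
  calc (r * y * r) * (r * x * r) = r * y * (r * r) * x * r := by group
    _ = r * (y * x) * r := by rw [hr]; group
    _ = r * x * (r * r) * y * r := by rw [← hc, hr]; group
    _ = _ := by group

theorem lamUp_mul_lamDown_equiv {m : ℕ} (i : Fin (m + 2 - 1)) (hi : i.val = m)
    (β : UVB (m + 2)) :
    ClosuresEquivalent (β * (lamUp i * lamDown i)) (β * (lamDown i * lamUp i)) := by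
  obtain ⟨i, hi'⟩ := i
  obtain rfl : i = m := hi
  -- Primed letters live on one additional strand, unprimed ones on two.
  set r' : UVB (i + 3) := rho ⟨i, by omega⟩ with hr'
  set s' : UVB (i + 3) := rho ⟨i + 1, by omega⟩ with hs'
  set x' : UVB (i + 3) := lamUp ⟨i, by omega⟩ with hx'
  set y' : UVB (i + 3) := lamUp ⟨i + 1, by omega⟩ with hy'
  have r2' : r' * r' = 1 := rho_mul_self _
  have s2' : s' * s' = 1 := rho_mul_self _
  have xsr' : x' * s' * r' = s' * r' * y' := lamUp_mul_rho rfl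
  have xy' : x' * y' = y' * x' := lamUp_commute_succ rfl
  set r : UVB (i + 4) := rho ⟨i, by omega⟩ with hr
  set s : UVB (i + 4) := rho ⟨i + 1, by omega⟩ with hs
  set t : UVB (i + 4) := rho ⟨i + 2, by omega⟩ with ht
  set x : UVB (i + 4) := lamUp ⟨i, by omega⟩ with hx
  set y : UVB (i + 4) := lamUp ⟨i + 1, by omega⟩ with hy
  set z : UVB (i + 4) := lamUp ⟨i + 2, by omega⟩ with hz
  have ur : up (i + 3) r' = r := up_rho _
  have us : up (i + 3) s' = s := up_rho _
  have ux : up (i + 3) x' = x := up_lamUp _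
  have uy : up (i + 3) y' = y := up_lamUp _
  set b' : UVB (i + 3) := up _ β with hb'
  set b : UVB (i + 4) := up _ b' with hb
  have far : Far (⟨i, by omega⟩ : Fin (i + 4 - 1)) ⟨i + 2, by omega⟩ := Or.inl le_rfl
  have key := conj_four (r := r) (s := s) (t := t) (x := x) (y := y) (z := z) (b := b)
    (rho_mul_self _) (rho_mul_self _) (rho_mul_self _) (rho_braid rfl) (rho_braid rfl)
    (eq_of_braidRel (.p2 _ _ far)) (lamUp_mul_rho rfl) (lamUp_mul_rho rfl)
    (lamUp_commute_rho far) (lamUp_commute_far far) (up_up_commute_rho β _ rfl)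
  have hX : up (i + 2) (lamUp ⟨i, hi'⟩) = x' := up_lamUp _
  have hR : up (i + 2) (rho ⟨i, hi'⟩) = r' := up_rho _
  have hD : up (i + 2) (lamDown ⟨i, hi'⟩) = r' * x' * r' := by
    rw [lamDown, map_mul, map_mul, hX, hR]
  -- split the last strand and exchange there
  have h1 : ClosuresEquivalent (β * (lamUp ⟨i, hi'⟩ * lamDown ⟨i, hi'⟩))
      (b' * s' * (r' * x' * r') * (s' * x' * s')) := by
    have h := ClosuresEquivalent.stabilize_mul (by omega) (β * lamUp ⟨i, hi'⟩) (lamDown ⟨i, hi'⟩) 1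
    rw [map_one, inv_one, one_mul, mul_one, map_mul, hX, hD, mul_assoc β] at h
    convert h using 1
    change _ = b' * x' * s' * (r' * x' * r')
    -- Moving $(23)$ to the left turns $\lambda_{12}$ into $\lambda_{13}$, which commutes with
    -- $\lambda_{21}$.
    calc b' * s' * (r' * x' * r') * (s' * x' * s')
        = b' * s' * ((s' * x' * s') * (r' * x' * r')) := by
          rw [commute_conj_three r2' s2' xsr' xy']; group
      _ = b' * (s' * s') * x' * s' * (r' * x' * r') := by group
      _ = _ := by rw [s2', mul_one]
  have h2 : ClosuresEquivalent (b' * s' * (r' * x' * r') * (s' * x' * s'))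
      (b * s * (r * x * r) * (r * s * r * t * (r * s * r)) * (s * x * s)) := by
    -- Conjugation by $(13)$ turns the new transposition $(34)$ into $(14)$: it is strand 1 that is
    -- split.
    have h := ClosuresEquivalent.stabilize_mul (by omega) (b' * s' * (r' * x' * r'))
      (s' * x' * s') (r' * s' * r')
    simp only [map_mul, ur, us, ux, mul_inv_rev] at h
    rw [hr, hs, rho_inv, rho_inv, ← hr, ← hs, ← mul_assoc r s r] at h
    exact h
  -- split the last strand but one and exchange there
  have h3 : ClosuresEquivalent (β * (lamDown ⟨i, hi'⟩ * lamUp ⟨i, hi'⟩))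
      (b' * (r' * s' * r') * x' * y') := by
    have h := ClosuresEquivalent.stabilize_mul (by omega) (β * lamDown ⟨i, hi'⟩) (lamUp ⟨i, hi'⟩)
      (rho ⟨i, hi'⟩)
    rw [hR, hr', rho_inv, ← hr', map_mul, hX, hD, mul_assoc β] at h
    convert h using 1
    change _ = b' * (r' * x' * r') * (r' * s' * r') * x'
    calc b' * (r' * s' * r') * x' * y' = b' * r' * s' * r' * (x' * y') := by group
      _ = b' * r' * (s' * r' * y') * x' := by rw [xy']; group
      _ = b' * r' * x' * s' * r' * x' := by rw [← xsr']; group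
      _ = b' * r' * x' * (r' * r') * s' * r' * x' := by rw [r2', mul_one]
      _ = _ := by group
  have h4 : ClosuresEquivalent (b' * (r' * s' * r') * x' * y')
      (b * (r * s * r) * x * (s * t * s) * y) := by
    -- Conjugation by $(23)$ turns $(34)$ into $(24)$: now strand 2 is split.
    have h := ClosuresEquivalent.stabilize_mul (by omega) (b' * (r' * s' * r') * x') y' s'
    simp only [map_mul, ur, us, ux, uy] at h
    rw [hs, rho_inv, ← hs] at h
    exact h
  have h5 := ClosuresEquivalent.conj
    (b * s * (r * x * r) * (r * s * r * t * (r * s * r)) * (s * x * s)) t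
  rw [ht, rho_inv, ← ht, key] at h5
  exact (((h1.trans h2).trans h5).trans h4.symm).trans h3.symm

/-! ### Passage to the quotient in which the two generators commute. -/

/-- Braids that can replace each other as factors, up to the equivalence of closures. -/
def factorCon (n : ℕ) : Con (UVB n) where
  r g h := ∀ β, ClosuresEquivalent (β * g) (β * h)
  iseqv := ⟨fun _ _ => .refl _, fun h β => (h β).symm, fun h h' β => (h β).trans (h' β)⟩
  mul' {g g' h h'} hg hh β := by
    -- A factor in the middle is rotated to the end, replaced there and rotated back, so the
    -- one-sided condition suffices.
    have h1 := ClosuresEquivalent.mul_comm (β * g) h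
    rw [← mul_assoc h] at h1
    have h2 := (h1.trans (hg (h * β))).trans ((mul_assoc h β g').symm ▸
      ClosuresEquivalent.mul_comm h (β * g'))
    simpa only [mul_assoc] using h2.trans (hh (β * g'))

theorem commute_map_of_mem_closure {G H : Type*} [Group G] [Group H] (f : G →* H)
    {S : Set G} (hS : ∀ x ∈ S, ∀ y ∈ S, Commute (f x) (f y)) {u v : G}
    (hu : u ∈ Subgroup.closure S) (hv : v ∈ Subgroup.closure S) : Commute (f u) (f v) := by
  induction hu, hv using Subgroup.closure_induction₂ with
  | mem x y hx hy => exact hS x hx y hy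
  | one_left => simp
  | one_right => simp
  | mul_left _ _ _ _ _ _ h h' => rw [map_mul]; exact h.mul_left h'
  | mul_right _ _ _ _ _ _ h h' => rw [map_mul]; exact h.mul_right h'
  | inv_left _ _ _ _ h => rw [map_inv]; exact h.inv_left
  | inv_right _ _ _ _ h => rw [map_inv]; exact h.inv_right

end FusedLinks

theorem mainTheorem4 (n : ℕ) (hn : 2 ≤ n) (α u v : FusedLinks.UVB n)
    (hα : α ∈ FusedLinks.UVP n)
    (hu : u ∈ Subgroup.closure
      {FusedLinks.lamUp (n := n) ⟨n - 2, by omega⟩, FusedLinks.lamDown (n := n) ⟨n - 2, by omega⟩})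
    (hv : v ∈ Subgroup.closure
      {FusedLinks.lamUp (n := n) ⟨n - 2, by omega⟩, FusedLinks.lamDown (n := n) ⟨n - 2, by omega⟩}) :
    FusedLinks.ClosuresEquivalent α (α * (u⁻¹ * v⁻¹ * u * v)) := by
  obtain ⟨m, rfl⟩ : ∃ m, n = m + 2 := ⟨n - 2, by omega⟩
  let f := (FusedLinks.factorCon (m + 2)).mk'
  have hxy : Commute (f (FusedLinks.lamUp ⟨m + 2 - 2, by omega⟩))
      (f (FusedLinks.lamDown ⟨m + 2 - 2, by omega⟩)) :=
    (Con.eq _).2 fun β => FusedLinks.lamUp_mul_lamDown_equiv _ rfl β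
  have huv : Commute (f u) (f v) := by
    refine FusedLinks.commute_map_of_mem_closure f ?_ hu hv
    rintro x (rfl | rfl) y (rfl | rfl)
    exacts [.refl _, hxy, hxy.symm, .refl _]
  -- The commutator is congruent to `1`; taking `β = α` in the definition of the congruence gives
  -- the claim.
  have h : f 1 = f (u⁻¹ * v⁻¹ * u * v) := by
    simp only [map_mul, map_inv, map_one]
    rw [mul_assoc, huv.eq]
    group
  have := (Con.eq _).1 h α
  rwa [mul_one] at this
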